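/- A hypergraph $\mathcal H=(V,E)$ consists of a finite set $V$ and a finite multiset $E$ of non-empty subsets of $V$. Its associated bipartite graph $\mathrm{Bip}\,\mathcal H$ has partite sets $V$ and $E$, with $v\in V$ adjacent to $e\in E$ if and only if $v\in e$; $\mathcal H$ is connected if $\mathrm{Bip}\,\mathcal H$ is connected. For $\emptyset\ne E'\subseteq E$ put $\mu(E')=|\bigcup E'|-c(E')$, where $c(E')$ is the number of connected components of the subgraph of $\mathrm{Bip}\,\mathcal H$ formed by $E'$, all edges incident with $E'$, and their end-vertices in $V$; put $\mu(\emptyset)=0$. Let $$P_{\mathcal H}=\Big\{a\in\mathbb Z_{\ge 0}^{E} : \sum_{e\in I}a_e\le \mu(I)\ \text{for all } I\subseteq E,\ \sum_{e\in E}a_e=\mu(E)\Big\}.$$ Fix any linear order on $E$. For $a\in P_{\mathcal H}$ let $\mathrm{Int}(a)$ be the set of all $e\in E$ such that $a-\mathbf e_e+\mathbf e_{e'}\notin P_{\mathcal H}$ for every $e'<e$, where $(\mathbf e_e)_{e\in E}$ is the canonical basis. The interior polynomial of $\mathcal H$ is $I_{\mathcal H}(x)=\sum_{a\in P_{\mathcal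 H}}x^{|E|-|\mathrm{Int}(a)|}$. Theorem. Let $\mathcal H=(V,E)$ be a connected hypergraph. Then for every integer $0\le k\le |E|$, the following are equivalent: (1) for all $0\le i\le k$, $$[x^i]I_{\mathcal H}(x)=\binom{\sum_{e\in E}\deg_{\mathrm{Bip}\,\mathcal H}(e)-|E|-|V|+i}{i};$$ (2) the length of a shortest cycle of $\mathrm{Bip}\,\mathcal H$ is at least $2k+2$ (regarded as satisfied if $\mathrm{Bip}\,\mathcal H$ has no cycle). Here $\binom{m}{i}=m(m-1)\cdots(m-i+1)/i!$ for $m\in\mathbb Z$, so that $\binom{m}{0}=1$. -/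

import Mathlib

open scoped BigOperators

noncomputable section

/-- A hypergraph with vertex set `V` and finite multiset of hyperedges: the multiset is given as
a family indexed by `E`, so that repeated hyperedges are different elements of `E`. -/
structure FinHypergraph (V E : Type*) where
  /-- The set of vertices of a hyperedge. -/
  verts : E → Finset V
  /-- Hyperedges are non-empty. -/
  verts_nonempty : ∀ e, (verts e).Nonempty

namespace Polymatroid

variable {E : Type*} [Fintype E]

/-- The set of integer vectors `a ≥ 0` with `∑ i ∈ I, a i ≤ f I` for all `I ⊆ E` and
`∑ i, a i = f E`: the polymatroid with rank function `f`. -/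
def baseSet (f : Finset E → ℤ) : Set (E → ℤ) :=
  {a | (∀ i, 0 ≤ a i) ∧ (∀ I : Finset E, ∑ i ∈ I, a i ≤ f I) ∧ ∑ i, a i = f Finset.univ}

theorem baseSet_finite (f : Finset E → ℤ) : (baseSet f).Finite := by
  classical
  refine (Set.finite_Icc (0 : E → ℤ) (fun i => f {i})).subset ?_
  rintro a ⟨h0, hI, -⟩
  exact ⟨fun i => h0 i, fun i => by simpa using hI {i}⟩

/-- The polymatroid with rank function `f`, as a finite set of vectors. -/
def bases (f : Finset E → ℤ) : Finset (E → ℤ) := (baseSet_finite f).toFinset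

variable [LinearOrder E]

/-- The index `i` is internally active for `a` if `a - e_i + e_j ∉ P` for all `j < i`. -/
def InternallyActive (P : Finset (E → ℤ)) (a : E → ℤ) (i : E) : Prop :=
  ∀ j, j < i → a - Pi.single i 1 + Pi.single j 1 ∉ P

open Classical in
/-- The set of internally active indices of `a`. -/
def internalSet (P : Finset (E → ℤ)) (a : E → ℤ) : Finset E :=
  {i | InternallyActive P a i}

/-- The interior polynomial `∑_{a ∈ P} x ^ (n - |Int a|)`, where `n = |E|`. -/
def interiorPolynomial (P : Finset (E → ℤ)) : Polynomial ℤ :=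
  ∑ a ∈ P, Polynomial.X ^ (Fintype.card E - (internalSet P a).card)

end Polymatroid

namespace FinHypergraph

variable {V E : Type*} (H : FinHypergraph V E)

/-- The associated bipartite graph: `v` and `e` are adjacent if and only if `v ∈ e`. -/
def bip : SimpleGraph (V ⊕ E) where
  Adj
    | .inl v, .inr e => v ∈ H.verts e
    | .inr e, .inl v => v ∈ H.verts e
    | _, _ => False
  symm := ⟨by rintro (v | e) (w | e') h <;> exact h⟩
  loopless := ⟨by rintro (v | e) h <;> exact h⟩

instance : DecidableRel H.bip.Adj := Classical.decRel _

/-- A hypergraph is connected if its associated bipartite graph is connected. -/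
def Connected : Prop := H.bip.Connected

/-- The union of the hyperedges in `F`. -/
def unionVerts (F : Finset E) : Set V := {v | ∃ e ∈ F, v ∈ H.verts e}

/-- The restriction of the associated bipartite graph to `F`, formed by the hyperedges in `F`,
all edges incident with them, and the end-vertices of these edges in `V`. -/
def bipRestrict (F : Finset E) :
    SimpleGraph ↥((Sum.inl '' H.unionVerts F ∪ Sum.inr '' (F : Set E)) : Set (V ⊕ E)) :=
  H.bip.induce _

/-- The number of connected components of the restriction to `F`. -/
def numComponents (F : Finset E) : ℕ := Nat.card (H.bipRestrict F).ConnectedComponent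

open Classical in
/-- The rank function `μ` of a hypergraph: `μ ∅ = 0` and `μ F = |⋃ F| - c F` otherwise. -/
def rank (F : Finset E) : ℤ :=
  if F = ∅ then 0 else ((H.unionVerts F).ncard : ℤ) - (H.numComponents F : ℤ)

/-- The finite set of hypertrees, that is, the polymatroid with rank function `μ`. -/
def hypertrees [Fintype E] : Finset (E → ℤ) := Polymatroid.bases H.rank

/-- The interior polynomial of a hypergraph. -/
def interiorPolynomial [Fintype E] [LinearOrder E] : Polynomial ℤ :=
  Polymatroid.interiorPolynomial H.hypertrees

end FinHypergraph

end

/-! Put `δ e = |e| - 1` and `ν I = ∑ e ∈ I, δ e - μ I`. Then `ν I` is the cyclomatic number of the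
bipartite graph restricted to `I`, a nonnegative supermodular function, and `a ↦ δ - a` carries
hypertrees to the vectors of least sum dominating `ν`.

Each vector dominating `ν` has exactly one minimal `b` below it that agrees with it at the inactive
indices of `b` (`exists_isMinimal_le_inactive`, `eq_of_inactive_eq`). Summing product weights over
the box `[0, M]^E`, `M > ν E`, along these fibres gives `(1 - X)^N * I + R = 1` with `N = ν E`
(`one_sub_X_pow_mul_sum_inactive`). Here `R` collects the non-dominating `d`, each contributing `(1
- X)^m * X^r` with `r` the number of entries below `M`.

The binomials in (1) are the coefficients of `(1 - X)^(-N)`, so (1) says that `R` vanishes through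
degree `k`. The lowest terms of `R` are positive and cannot cancel, so this means `ν I = 0` whenever
`|I| ≤ k`: at most `k` hyperedges always span a forest. That is (2), since a cycle through `m`
hyperedges has length `2m`. -/

noncomputable section

namespace Polymatroid

/-! ### Supermodular functions, tight sets and minimal dominating vectors -/

section Supermodular

variable {E : Type*} {ν : Finset E → ℤ} {c b : E → ℤ}

/-- The vector `c` dominates the set function `ν`. -/
def Dominates (ν : Finset E → ℤ) (c : E → ℤ) : Prop := ∀ I, ν I ≤ ∑ i ∈ I, c i

/-- The set `I` is tight for `c`. -/
def Tight (ν : Finset E → ℤ) (c : E → ℤ) (I : Finset E) : Prop := ∑ i ∈ I, c i = ν I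

/-- No tight set obstructs moving a unit from coordinate `j` to coordinate `i`. -/
def Transferable (ν : Finset E → ℤ) (c : E → ℤ) (i j : E) : Prop :=
  ∀ S : Finset E, j ∈ S → Tight ν c S → i ∈ S

theorem Dominates.mono (hb : Dominates ν b) (h : b ≤ c) : Dominates ν c :=
  fun I => (hb I).trans (Finset.sum_le_sum fun i _ => h i)

variable [DecidableEq E]

/-- A normalized nonnegative supermodular set function. -/
structure IsSupermodular (ν : Finset E → ℤ) : Prop where
  empty : ν ∅ = 0
  nonneg : ∀ I, 0 ≤ ν I
  add_le : ∀ I J, ν I + ν J ≤ ν (I ∪ J) + ν (I ∩ J)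

theorem Dominates.nonneg (hν : IsSupermodular ν) (hc : Dominates ν c) (i : E) : 0 ≤ c i := by
  simpa using (hν.nonneg {i}).trans (hc {i})

theorem Tight.union_inter (hν : IsSupermodular ν) (hc : Dominates ν c) {I J : Finset E}
    (hI : Tight ν c I) (hJ : Tight ν c J) : Tight ν c (I ∪ J) ∧ Tight ν c (I ∩ J) := by
  have h := Finset.sum_union_inter (s₁ := I) (s₂ := J) (f := c)
  have h1 := hν.add_le I J
  have h2 := hc (I ∪ J)
  have h3 := hc (I ∩ J)
  unfold Tight at *
  constructor <;> linarith

theorem tight_empty (hν : IsSupermodular ν) : Tight ν c ∅ := by simp [Tight, hν.empty]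

theorem sum_single_one (I : Finset E) (i : E) :
    ∑ x ∈ I, (Pi.single i (1 : ℤ) : E → ℤ) x = if i ∈ I then 1 else 0 := by
  simp [Finset.sum_pi_single']

theorem sum_transfer (I : Finset E) (b : E → ℤ) (i j : E) :
    ∑ x ∈ I, (b + Pi.single i 1 - Pi.single j 1 : E → ℤ) x =
      ∑ x ∈ I, b x + (if i ∈ I then 1 else 0) - (if j ∈ I then 1 else 0) := by
  simp only [Pi.sub_apply, Pi.add_apply, Finset.sum_sub_distrib, Finset.sum_add_distrib,
    sum_single_one]

/-- Only sets containing `j` but not `i` lose weight, and they lose exactly one; by integrality only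
tight ones are violated. -/
theorem dominates_transfer_iff (hb : Dominates ν b) {i j : E} :
    Dominates ν (b + Pi.single i 1 - Pi.single j 1 : E → ℤ) ↔ Transferable ν b i j := by
  refine ⟨fun h S hj hS => ?_, fun h S => ?_⟩
  · by_contra hi
    have := h S
    rw [sum_transfer, if_neg hi, if_pos hj] at this
    unfold Tight at hS
    linarith
  · rw [sum_transfer]
    have h1 := hb S
    by_cases hj : j ∈ S
    · by_cases hS : Tight ν b S
      · simp [h S hj hS, hj, h1]
      · have : ν S ≠ ∑ i ∈ S, b i := fun h' => hS h'.symm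
        rw [if_pos hj]
        split_ifs <;> omega
    · rw [if_neg hj]
      split_ifs <;> omega

theorem IsSupermodular.mono (hν : IsSupermodular ν) {I J : Finset E} (h : I ⊆ J) :
    ν I ≤ ν J := by
  have h1 := hν.add_le I (J \ I)
  have h2 := hν.nonneg (J \ I)
  rw [Finset.union_sdiff_of_subset h, Finset.inter_sdiff_self, hν.empty] at h1
  omega

/-- If every index lies in a tight set, then the whole set is tight. -/
theorem tight_univ [Fintype E] (hν : IsSupermodular ν) (hc : Dominates ν c)
    (h : ∀ i, ∃ S, i ∈ S ∧ Tight ν c S) : Tight ν c Finset.univ := by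
  have key : ∀ s : Finset E, ∃ T, s ⊆ T ∧ Tight ν c T := by
    intro s
    induction s using Finset.induction_on with
    | empty => exact ⟨∅, subset_rfl, tight_empty hν⟩
    | insert i s _ ih =>
      obtain ⟨T, hT, hT'⟩ := ih
      obtain ⟨S, hS, hS'⟩ := h i
      refine ⟨S ∪ T, ?_, (hS'.union_inter hν hc hT').1⟩
      exact Finset.insert_subset (Finset.mem_union_left _ hS) (hT.trans Finset.subset_union_right)
  obtain ⟨T, hT, hT'⟩ := key Finset.univ
  rwa [← Finset.univ_subset_iff.mp hT]

/-- The vectors of minimal sum dominating `ν`. -/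
def IsMinimal [Fintype E] (ν : Finset E → ℤ) (b : E → ℤ) : Prop :=
  Dominates ν b ∧ ∑ i, b i = ν Finset.univ

theorem IsMinimal.le_rank [Fintype E] (hν : IsSupermodular ν) (hb : IsMinimal ν b) (i : E) :
    b i ≤ ν Finset.univ := by
  rw [← hb.2]
  exact Finset.single_le_sum (fun j _ => hb.1.nonneg hν j) (Finset.mem_univ i)

/-- A coordinate in no tight set can be lowered by one; by `tight_univ` such a coordinate exists
until the sum is minimal. -/
theorem exists_isMinimal_le [Fintype E] (hν : IsSupermodular ν) (hc : Dominates ν c) :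
    ∃ b, IsMinimal ν b ∧ b ≤ c := by
  obtain ⟨n, hn⟩ : ∃ n : ℕ, ∑ i, c i = ν Finset.univ + n :=
    ⟨(∑ i, c i - ν Finset.univ).toNat, by have := hc Finset.univ; omega⟩
  induction n generalizing c with
  | zero => exact ⟨c, ⟨hc, by simpa using hn⟩, le_rfl⟩
  | succ n ih =>
    have hnt : ¬ Tight ν c Finset.univ := by unfold Tight; omega
    obtain ⟨i, hi⟩ : ∃ i, ∀ S, i ∈ S → ¬ Tight ν c S := by
      by_contra! h
      exact hnt (tight_univ hν hc h)
    have hsum : ∀ I : Finset E, ∑ x ∈ I, (c - Pi.single i 1 : E → ℤ) x =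
        ∑ x ∈ I, c x - if i ∈ I then 1 else 0 := fun I => by
      simp only [Pi.sub_apply, Finset.sum_sub_distrib, sum_single_one]
    have hle : c - Pi.single i 1 ≤ c := by
      rw [sub_le_self_iff, Pi.le_def]
      intro x
      by_cases hx : x = i
      · subst hx; simp
      · simp [hx]
    obtain ⟨b, hb, hbc⟩ := ih (c := c - Pi.single i 1) (fun S => by
      rw [hsum]
      have h1 := hc S
      split_ifs with h
      · have : ν S ≠ ∑ i ∈ S, c i := fun h' => hi S h h'.symm
        omega
      · omega) (by rw [hsum, if_pos (Finset.mem_univ i), hn]; push_cast; ring)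
    exact ⟨b, hb, hbc.trans hle⟩

end Supermodular

/-! ### Unique minimal vector below a dominating one -/

section Activity

variable {E : Type*} [Fintype E] [LinearOrder E] {ν : Finset E → ℤ} {c b b' : E → ℤ}

/-- The index `i` admits a transfer from some smaller index. -/
def Inactive (ν : Finset E → ℤ) (b : E → ℤ) (i : E) : Prop := ∃ j < i, Transferable ν b i j

/-- Among minimal vectors below `c`, take one whose mass sits on indices as large as possible. A
transfer from `j < i` to `i` would improve it, so only the bound `c i` can block it. -/
theorem exists_isMinimal_le_inactive (hν : IsSupermodular ν) (hc : Dominates ν c) :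
    ∃ b, IsMinimal ν b ∧ b ≤ c ∧ ∀ i, Inactive ν b i → b i = c i := by
  classical
  let pos : E → ℤ := fun i => ((Finset.univ.filter (· < i)).card : ℤ)
  have hpos : ∀ i j, j < i → pos j < pos i := fun i j hji => by
    simp only [pos, Nat.cast_lt]
    refine Finset.card_lt_card ((Finset.ssubset_iff_of_subset fun x hx => ?_).mpr ⟨j, ?_, ?_⟩)
    · simp only [Finset.mem_filter, Finset.mem_univ, true_and] at hx ⊢
      exact hx.trans hji
    · simpa using hji
    · simp
  let s : Finset (E → ℤ) := (Finset.Icc 0 c).filter fun b => IsMinimal ν b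
  have hs : ∀ b, b ∈ s ↔ IsMinimal ν b ∧ b ≤ c := fun b => by
    simp only [s, Finset.mem_filter, Finset.mem_Icc]
    exact ⟨fun h => ⟨h.2, h.1.2⟩, fun h => ⟨⟨fun i => h.1.1.nonneg hν i, h.2⟩, h.1⟩⟩
  obtain ⟨b₀, hb₀⟩ := exists_isMinimal_le hν hc
  obtain ⟨b, hb, hmax⟩ := s.exists_max_image (fun b => ∑ i, b i * pos i) ⟨b₀, (hs _).2 hb₀⟩
  obtain ⟨hbm, hbc⟩ := (hs b).1 hb
  refine ⟨b, hbm, hbc, fun i ⟨j, hji, hij⟩ => ?_⟩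
  by_contra hne
  have hlt : b i < c i := lt_of_le_of_ne (hbc i) hne
  have hmem : (b + Pi.single i 1 - Pi.single j 1 : E → ℤ) ∈ s := by
    refine (hs _).2 ⟨⟨(dominates_transfer_iff hbm.1).2 hij, ?_⟩, fun x => ?_⟩
    · rw [sum_transfer]
      simp [hbm.2]
    · have : b x ≤ c x := hbc x
      by_cases hx : x = i
      · subst hx
        simp only [Pi.sub_apply, Pi.add_apply, Pi.single_eq_same, Pi.single_eq_of_ne hji.ne']
        omega
      · by_cases hx' : x = j
        · subst hx'
          simp only [Pi.sub_apply, Pi.add_apply, Pi.single_eq_same, Pi.single_eq_of_ne hx]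
          omega
        · simpa [hx, hx'] using this
  have := hmax _ hmem
  simp only [Pi.sub_apply, Pi.add_apply, sub_mul, add_mul, Finset.sum_sub_distrib,
    Finset.sum_add_distrib, Pi.single_apply, ite_mul, one_mul, zero_mul, Finset.sum_ite_eq',
    Finset.mem_univ, if_true] at this
  have := hpos i j hji
  omega

/-- Let `T` be the least tight set containing `j`. Since `b'` dominates `ν` and `b` is tight on `T`,
the deficit at `j` is compensated at some `i ∈ T`, and such an `i` lies in every tight set
containing `j`. -/
theorem exists_transferable_of_lt (hν : IsSupermodular ν) (hb : IsMinimal ν b)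
    (hb' : Dominates ν b') {j : E} (hj : b' j < b j) :
    ∃ i, b i < b' i ∧ Transferable ν b i j := by
  obtain ⟨T, ⟨hjT, hT⟩, hmin⟩ := exists_minimal_of_wellFoundedLT
    (fun S : Finset E => j ∈ S ∧ Tight ν b S) ⟨Finset.univ, Finset.mem_univ j, hb.2⟩
  by_contra! h
  have hsum : ∑ i ∈ T, b' i < ∑ i ∈ T, b i := by
    refine Finset.sum_lt_sum (fun i hi => ?_) ⟨j, hjT, hj⟩
    by_contra! hlt
    refine h i hlt fun S hjS hS => ?_
    have := hmin ⟨Finset.mem_inter.2 ⟨hjT, hjS⟩, (hT.union_inter hν hb.1 hS).2⟩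
      Finset.inter_subset_left
    exact (Finset.mem_inter.1 (this hi)).2
  have := hb' T
  unfold Tight at hT
  omega

/-- At the first disagreement `j`, the larger vector admits a transfer to some `i > j` where it is
the smaller one. So `i` is inactive for it and its entry there is already `c i`, leaving no room for
the other. -/
theorem eq_of_inactive_eq (hν : IsSupermodular ν) (hb : IsMinimal ν b) (hbc : b ≤ c)
    (hbi : ∀ i, Inactive ν b i → b i = c i) (hb' : IsMinimal ν b') (hbc' : b' ≤ c)
    (hbi' : ∀ i, Inactive ν b' i → b' i = c i) : b = b' := by
  by_contra hne
  have hex : (Finset.univ.filter fun i => b i ≠ b' i).Nonempty := by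
    obtain ⟨i, hi⟩ := Function.ne_iff.1 hne
    exact ⟨i, by simpa using hi⟩
  set j := (Finset.univ.filter fun i => b i ≠ b' i).min' hex with hjdef
  have hj : b j ≠ b' j := by simpa using Finset.min'_mem _ hex
  have hlt : ∀ i, b i ≠ b' i → i ≠ j → j < i := fun i hi hij =>
    lt_of_le_of_ne (Finset.min'_le _ _ (by simpa using hi)) hij.symm
  rcases lt_or_gt_of_ne hj with h | h
  · obtain ⟨i, hi, hij⟩ := exists_transferable_of_lt hν hb' hb.1 h
    have := hbi' i ⟨j, hlt i hi.ne' (fun h' => by subst h'; omega), hij⟩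
    have : b i ≤ c i := hbc i
    omega
  · obtain ⟨i, hi, hij⟩ := exists_transferable_of_lt hν hb hb'.1 h
    have := hbi i ⟨j, hlt i hi.ne (fun h' => by subst h'; omega), hij⟩
    have : b' i ≤ c i := hbc' i
    omega

end Activity

end Polymatroid

namespace Polymatroid
open Polynomial

/-! ### Weighted count over a box and low-degree coefficients -/

section Counting

/-- The weight of the coordinate value `j` in a box of side `M`. -/
def weight (M j : ℤ) : ℤ[X] := (1 - X) ^ j.toNat * if j < M then X else 1

/-- Telescoping: for `0 ≤ j < M` the weight is `(1 - X)^j - (1 - X)^(j + 1)`, and the last term is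
`(1 - X)^M`. -/
theorem sum_weight_Icc {M p : ℤ} (hp : 0 ≤ p) (hpM : p ≤ M) :
    ∑ j ∈ Finset.Icc p M, weight M j = (1 - X) ^ p.toNat := by
  lift p to ℕ using hp
  obtain ⟨n, hn⟩ : ∃ n : ℕ, M = p + n := ⟨(M - p).toNat, by omega⟩
  induction n generalizing p with
  | zero => simp [hn, weight]
  | succ n ih =>
    have h1 : Finset.Icc (p : ℤ) M = insert (p : ℤ) (Finset.Icc ((p + 1 : ℕ) : ℤ) M) := by
      ext x
      simp only [Finset.mem_Icc, Finset.mem_insert]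
      omega
    rw [h1, Finset.sum_insert (by simp), ih (p + 1) (by omega) (by omega)]
    have h2 : (p : ℤ) < M := by omega
    simp only [weight, h2, if_true, Int.toNat_natCast]
    ring

variable {E : Type*} [Fintype E]

theorem prod_weight (M : ℤ) (d : E → ℤ) :
    ∏ i, weight M (d i) =
      (1 - X) ^ (∑ i, (d i).toNat) * X ^ (Finset.univ.filter fun i => d i < M).card := by
  simp only [weight, Finset.prod_mul_distrib, Finset.prod_pow_eq_pow_sum]
  rw [← Finset.prod_filter, Finset.prod_const]

theorem coeff_one_sub_X_pow_mul_X_pow_of_lt (m : ℕ) {r i : ℕ} (h : i < r) :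
    ((1 - X) ^ m * X ^ r : ℤ[X]).coeff i = 0 := by
  rw [coeff_mul_X_pow', if_neg (by omega)]

theorem coeff_one_sub_X_pow_mul_X_pow_self (m r : ℕ) :
    ((1 - X) ^ m * X ^ r : ℤ[X]).coeff r = 1 := by
  simp [coeff_mul_X_pow', coeff_zero_eq_eval_zero]

variable [LinearOrder E] {ν : Finset E → ℤ}

/-- The fibre over a minimal vector `b` of the map sending a vector of the box to the minimal
vector below it. -/
theorem sum_box_fibre (hν : IsSupermodular ν) {b : E → ℤ} (hb : IsMinimal ν b) {M : ℤ}
    (hM : ν Finset.univ < M) [DecidablePred (Inactive ν b)] :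
    ∑ d ∈ Fintype.piFinset (fun i => if Inactive ν b i then {b i} else Finset.Icc (b i) M),
      ∏ i, weight M (d i) = (1 - X) ^ (ν Finset.univ).toNat *
        X ^ (Finset.univ.filter (Inactive ν b)).card := by
  rw [← Finset.prod_univ_sum]
  have h1 : ∀ i, ∑ j ∈ (if Inactive ν b i then {b i} else Finset.Icc (b i) M), weight M j =
      (1 - X) ^ (b i).toNat * if Inactive ν b i then X else 1 := fun i => by
    have h2 := hb.le_rank hν i
    split_ifs with h
    · simp [weight, h2.trans_lt hM]
    · rw [sum_weight_Icc (hb.1.nonneg hν i) (h2.trans hM.le), mul_one]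
  rw [Finset.prod_congr rfl fun i _ => h1 i, Finset.prod_mul_distrib,
    Finset.prod_pow_eq_pow_sum, ← Finset.prod_filter, Finset.prod_const]
  congr 2
  rw [← hb.2]
  zify
  rw [Int.toNat_of_nonneg (Finset.sum_nonneg fun i _ => hb.1.nonneg hν i)]
  exact Finset.sum_congr rfl fun i _ => Int.toNat_of_nonneg (hb.1.nonneg hν i)

open Classical in
/-- Summing the weights of all vectors in a box yields a relation between the inactivity
enumerator of minimal vectors and the vectors in the box which are not dominating. -/
theorem one_sub_X_pow_mul_sum_inactive (hν : IsSupermodular ν) {Q : Finset (E → ℤ)}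
    (hQ : ∀ b, b ∈ Q ↔ IsMinimal ν b) {M : ℤ} (hM : ν Finset.univ < M) :
    (1 - X) ^ (ν Finset.univ).toNat *
        ∑ b ∈ Q, (X : ℤ[X]) ^ (Finset.univ.filter (Inactive ν b)).card +
      ∑ d ∈ Fintype.piFinset (fun _ : E => Finset.Icc 0 M) with ¬ Dominates ν d,
        ∏ i, weight M (d i) = 1 := by
  have hM0 : 0 ≤ M := (hν.nonneg _).trans hM.le
  have htotal : ∑ d ∈ Fintype.piFinset (fun _ : E => Finset.Icc 0 M),
      ∏ i, weight M (d i) = 1 := by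
    rw [← Finset.prod_univ_sum]
    simp [sum_weight_Icc le_rfl hM0]
  refine Eq.trans ?_ htotal
  rw [← Finset.sum_filter_add_sum_filter_not (Fintype.piFinset fun _ : E => Finset.Icc 0 M)
    (fun d => Dominates ν d), Finset.mul_sum]
  congr 1
  rw [← Finset.sum_congr rfl fun b hb => sum_box_fibre hν ((hQ b).1 hb) hM]
  have hmem : ∀ b d : E → ℤ, d ∈ Fintype.piFinset
      (fun i => if Inactive ν b i then {b i} else Finset.Icc (b i) M) → IsMinimal ν b →
      b ≤ d ∧ d ≤ (fun _ => M) ∧ ∀ i, Inactive ν b i → b i = d i := by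
    intro b d hd hb
    rw [Fintype.mem_piFinset] at hd
    have h : ∀ i, b i ≤ d i ∧ d i ≤ M ∧ (Inactive ν b i → b i = d i) := fun i => by
      have h1 := hd i
      have h2 := hb.le_rank hν i
      split_ifs at h1 with h
      · rw [Finset.mem_singleton] at h1
        exact ⟨h1.ge, h1.le.trans (h2.trans hM.le), fun _ => h1.symm⟩
      · rw [Finset.mem_Icc] at h1
        exact ⟨h1.1, h1.2, fun h' => absurd h' h⟩
    exact ⟨fun i => (h i).1, fun i => (h i).2.1, fun i => (h i).2.2⟩
  rw [← Finset.sum_biUnion]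
  · refine Finset.sum_congr ?_ fun _ _ => rfl
    ext d
    simp only [Finset.mem_biUnion, Finset.mem_filter]
    constructor
    · rintro ⟨b, hb, hd⟩
      obtain ⟨h1, h2, -⟩ := hmem b d hd ((hQ b).1 hb)
      have h3 := ((hQ b).1 hb).1.mono h1
      refine ⟨?_, h3⟩
      rw [Fintype.mem_piFinset]
      exact fun i => Finset.mem_Icc.2 ⟨h3.nonneg hν i, h2 i⟩
    · rintro ⟨hd, hdom⟩
      obtain ⟨b, hb, hbd, hbi⟩ := exists_isMinimal_le_inactive hν hdom
      refine ⟨b, (hQ b).2 hb, ?_⟩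
      rw [Fintype.mem_piFinset] at hd ⊢
      intro i
      split_ifs with h
      · exact Finset.mem_singleton.2 (hbi i h).symm
      · exact Finset.mem_Icc.2 ⟨hbd i, (Finset.mem_Icc.1 (hd i)).2⟩
  · intro b hb b' hb' hne
    refine Finset.disjoint_left.2 fun d hd hd' => hne ?_
    have hb := (hQ b).1 hb
    have hb' := (hQ b').1 hb'
    obtain ⟨h1, -, h2⟩ := hmem b d hd hb
    obtain ⟨h1', -, h2'⟩ := hmem b' d hd' hb'
    exact eq_of_inactive_eq hν hb h1 h2 hb' h1' h2'

/-- A vector of a large box which does not dominate `ν` violates the inequality of a set on which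
all its entries are small. -/
theorem exists_forall_lt_of_not_dominates (hν : IsSupermodular ν) {M : ℤ}
    (hM : ν Finset.univ < M) {d : E → ℤ} (hd : ∀ i, 0 ≤ d i) (h : ¬ Dominates ν d) :
    ∃ I, 0 < ν I ∧ ∀ i ∈ I, d i < M := by
  simp only [Dominates, not_forall, not_le] at h
  obtain ⟨I, hI⟩ := h
  refine ⟨I, (Finset.sum_nonneg fun i _ => hd i).trans_lt hI, fun i hi => ?_⟩
  have h1 := Finset.single_le_sum (fun j _ => hd j) hi
  have h2 := hν.mono (Finset.subset_univ I)
  omega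

/-- With `u = (1 - X)^(-N)`, the series `u - P = u * R` and `R` differ by a unit, so they vanish to
the same order. -/
theorem coeff_eq_choose_iff_of_one_sub_X_pow_mul_add {R P : ℤ[X]} {N k : ℕ}
    (h : (1 - X) ^ N * P + R = 1) :
    (∀ i ≤ k, P.coeff i = Ring.choose ((N : ℤ) - 1 + i) i) ↔ ∀ i ≤ k, R.coeff i = 0 := by
  set u := (PowerSeries.invOneSubPow ℤ N).val with hu
  have hcoeff : ∀ i, PowerSeries.coeff i u = Ring.choose ((N : ℤ) - 1 + i) i := fun i => by
    -- For `N = 0` the binomial is `choose (i - 1) i`, which is `0` for `i > 0` and `1` for `i = 0`.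
    rcases N with _ | N
    · rcases i with _ | i
      · simp [hu, PowerSeries.invOneSubPow_zero]
      · have : ((0 : ℕ) : ℤ) - 1 + ((i + 1 : ℕ) : ℤ) = (i : ℤ) := by push_cast; ring
        rw [this, Ring.choose_natCast, hu, PowerSeries.invOneSubPow_zero]
        simp [PowerSeries.coeff_one]
    · have : ((N + 1 : ℕ) : ℤ) - 1 + (i : ℤ) = ((N + i : ℕ) : ℤ) := by push_cast; ring
      rw [this, Ring.choose_natCast, hu, PowerSeries.invOneSubPow_val_succ_eq_mk_add_choose,
        PowerSeries.coeff_mk, Nat.choose_symm_add]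
  have hinv : u * (1 - PowerSeries.X) ^ N = 1 := by
    rw [← PowerSeries.invOneSubPow_inv_eq_one_sub_pow, hu]
    exact Units.val_inv _
  have hP : (P : PowerSeries ℤ) = u - u * (R : PowerSeries ℤ) := by
    have h1 : (1 - PowerSeries.X) ^ N * (P : PowerSeries ℤ) + (R : PowerSeries ℤ) = 1 := by
      have := congrArg (coeToPowerSeries.ringHom (R := ℤ)) h
      simpa using this
    linear_combination (-(P : PowerSeries ℤ)) * hinv + u * h1
  have hR : (R : PowerSeries ℤ) = (1 - PowerSeries.X) ^ N * (u - (P : PowerSeries ℤ)) := by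
    rw [hP]
    linear_combination (-(R : PowerSeries ℤ)) * hinv
  have hzero : ∀ A B : PowerSeries ℤ, (∀ i ≤ k, PowerSeries.coeff i B = 0) →
      ∀ i ≤ k, PowerSeries.coeff i (A * B) = 0 := fun A B hB i hi => by
    rw [PowerSeries.coeff_mul]
    refine Finset.sum_eq_zero fun x hx => ?_
    rw [hB x.2 (by have := Finset.HasAntidiagonal.mem_antidiagonal.1 hx; omega), mul_zero]
  simp only [← hcoeff, ← coeff_coe]
  constructor
  · intro h' i hi
    rw [hR]
    exact hzero _ _ (fun j hj => by rw [map_sub, h' j hj, sub_self]) i hi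
  · intro h' i hi
    rw [hP, map_sub, hzero _ _ h' i hi, sub_zero]

open Classical in
theorem forall_coeff_sum_inactive_iff (hν : IsSupermodular ν) {Q : Finset (E → ℤ)}
    (hQ : ∀ b, b ∈ Q ↔ IsMinimal ν b) (k : ℕ) :
    (∀ i ≤ k, (∑ b ∈ Q, (X : ℤ[X]) ^ (Finset.univ.filter (Inactive ν b)).card).coeff i =
        Ring.choose (ν Finset.univ - 1 + i) i) ↔
      ∀ I : Finset E, I.card ≤ k → ν I = 0 := by
  have hM : ν Finset.univ < ν Finset.univ + 1 := lt_add_one _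
  set M := ν Finset.univ + 1
  have key := coeff_eq_choose_iff_of_one_sub_X_pow_mul_add (k := k)
    (one_sub_X_pow_mul_sum_inactive hν hQ hM)
  rw [Int.toNat_of_nonneg (hν.nonneg _)] at key
  rw [key]
  simp only [prod_weight, finsetSum_coeff]
  have hcard : ∀ (d : E → ℤ) (I : Finset E), (∀ i ∈ I, d i < M) →
      I.card ≤ (Finset.univ.filter fun i => d i < M).card := fun d I h =>
    Finset.card_le_card fun i hi => by simpa using h i hi
  constructor
  · intro h
    by_contra! hI
    obtain ⟨I₀, hI₀, hne⟩ := hI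
    obtain ⟨I, hI, hmin⟩ := (Finset.univ.filter fun I => ν I ≠ 0).exists_min_image Finset.card
      ⟨I₀, by simpa using hne⟩
    simp only [Finset.mem_filter, Finset.mem_univ, true_and] at hI hmin
    have hpos : 0 < ν I := lt_of_le_of_ne (hν.nonneg I) hI.symm
    have hM0 : 0 < M := (hν.nonneg _).trans_lt hM
    -- This vector violates the inequality of `I` and is below `M` exactly on `I`, so it contributes
    -- `1` in degree `I.card`; minimality of `I` makes all other contributions there nonnegative.
    let d₀ : E → ℤ := fun i => if i ∈ I then 0 else M
    have hd₀ : (Finset.univ.filter fun i => d₀ i < M) = I := by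
      ext i
      by_cases hi : i ∈ I <;> simp [d₀, hi, hM0]
    refine (Finset.sum_pos' (fun d hd => ?_) ⟨d₀, ?_, ?_⟩).ne' (h I.card ((hmin I₀ hne).trans hI₀))
    · simp only [Finset.mem_filter, Fintype.mem_piFinset, Finset.mem_Icc] at hd
      obtain ⟨J, hJ, hlt⟩ := exists_forall_lt_of_not_dominates hν hM (fun i => (hd.1 i).1) hd.2
      rcases ((hmin J hJ.ne').trans (hcard d J hlt)).lt_or_eq with h1 | h1
      · rw [coeff_one_sub_X_pow_mul_X_pow_of_lt _ h1]
      · rw [h1, coeff_one_sub_X_pow_mul_X_pow_self]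
        exact zero_le_one
    · simp only [Finset.mem_filter, Fintype.mem_piFinset, Finset.mem_Icc]
      refine ⟨fun i => ?_, fun h' => ?_⟩
      · by_cases hi : i ∈ I <;> simp [d₀, hi, hM0.le]
      · have := h' I
        rw [Finset.sum_congr rfl fun i hi => if_pos hi, Finset.sum_const_zero] at this
        exact this.not_gt hpos
    · rw [hd₀, coeff_one_sub_X_pow_mul_X_pow_self]
      exact zero_lt_one
  · intro h i hi
    refine Finset.sum_eq_zero fun d hd => coeff_one_sub_X_pow_mul_X_pow_of_lt _ ?_
    simp only [Finset.mem_filter, Fintype.mem_piFinset, Finset.mem_Icc] at hd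
    obtain ⟨I, hI, hlt⟩ := exists_forall_lt_of_not_dominates hν hM (fun i => (hd.1 i).1) hd.2
    by_contra! hle
    exact hI.ne' (h I (((hcard d I hlt).trans hle).trans hi))

end Counting

/-! ### Passing from a polymatroid to its complement -/

section Complement

variable {E : Type*} [Fintype E] [LinearOrder E] {f : Finset E → ℤ} {δ : E → ℤ}

theorem mem_bases_iff (hf : Monotone f) {a : E → ℤ} :
    a ∈ bases f ↔ IsMinimal (fun I => ∑ i ∈ I, δ i - f I) (δ - a) := by
  have hdom : Dominates (fun I => ∑ i ∈ I, δ i - f I) (δ - a) ↔ ∀ I, ∑ i ∈ I, a i ≤ f I := by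
    refine forall_congr' fun I => ?_
    simp only [Pi.sub_apply, Finset.sum_sub_distrib, sub_le_sub_iff_left]
  have hsum : ∑ i, (δ - a) i = ∑ i, δ i - f Finset.univ ↔ ∑ i, a i = f Finset.univ := by
    simp only [Pi.sub_apply, Finset.sum_sub_distrib, sub_right_inj]
  rw [IsMinimal, hdom, hsum, bases, Set.Finite.mem_toFinset]
  -- Nonnegativity is automatic: `a i ≥ f univ - f (univ.erase i) ≥ 0` by monotonicity.
  refine ⟨fun h => h.2, fun h => ⟨fun i => ?_, h⟩⟩
  have h1 := h.1 (Finset.univ.erase i)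
  have h2 := hf (Finset.erase_subset i Finset.univ)
  have h3 := Finset.add_sum_erase Finset.univ a (Finset.mem_univ i)
  have h4 := h.2
  omega

theorem not_internallyActive_iff (hf : Monotone f) {a : E → ℤ} (ha : a ∈ bases f) (i : E) :
    ¬ InternallyActive (bases f) a i ↔ Inactive (fun I => ∑ i ∈ I, δ i - f I) (δ - a) i := by
  have hmin := (mem_bases_iff (δ := δ) hf).1 ha
  simp only [InternallyActive, Inactive, not_forall, not_not, exists_prop]
  refine exists_congr fun j => and_congr_right fun _ => ?_
  rw [mem_bases_iff (δ := δ) hf, ← dominates_transfer_iff hmin.1,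
    show δ - (a - Pi.single i 1 + Pi.single j 1) = δ - a + Pi.single i 1 - Pi.single j 1 by abel]
  refine ⟨fun h => h.1, fun h => ⟨h, ?_⟩⟩
  rw [sum_transfer, hmin.2]
  simp

open Classical in
theorem interiorPolynomial_bases (hf : Monotone f) :
    interiorPolynomial (bases f) = ∑ b ∈ (bases f).image (δ - ·),
      X ^ (Finset.univ.filter (Inactive (fun I => ∑ i ∈ I, δ i - f I) b)).card := by
  rw [Finset.sum_image fun a _ a' _ h => sub_right_injective h]
  refine Finset.sum_congr rfl fun a ha => ?_
  have h : Finset.univ.filter (Inactive (fun I => ∑ i ∈ I, δ i - f I) (δ - a)) =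
      (internalSet (bases f) a)ᶜ := by
    ext i
    simp [internalSet, ← not_internallyActive_iff (δ := δ) hf ha]
  rw [h, Finset.card_compl]

/-- Comparison of the low-degree coefficients of the interior polynomial with those of a power of
`1 / (1 - X)`. -/
theorem forall_coeff_interiorPolynomial_iff (hf : Monotone f)
    (hν : IsSupermodular fun I => ∑ i ∈ I, δ i - f I) (k : ℕ) :
    (∀ i ≤ k, (interiorPolynomial (bases f)).coeff i =
        Ring.choose (∑ i, δ i - f Finset.univ - 1 + i) i) ↔
      ∀ I : Finset E, I.card ≤ k → ∑ i ∈ I, δ i = f I := by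
  classical
  rw [interiorPolynomial_bases (δ := δ) hf]
  rw [forall_coeff_sum_inactive_iff hν (Q := (bases f).image (δ - ·)) (fun b => ?_) k]
  · simp only [sub_eq_zero]
  · rw [Finset.mem_image]
    refine ⟨?_, fun h => ⟨δ - b, (mem_bases_iff (δ := δ) hf).2 (by simpa using h), by simp⟩⟩
    rintro ⟨a, ha, rfl⟩
    exact (mem_bases_iff hf).1 ha

end Complement

end Polymatroid

/-! ### Forests characterized by counting vertices, edges and components -/

namespace SimpleGraph

theorem isAcyclic_iff_forall_isTree_toSimpleGraph {W : Type*} {G : SimpleGraph W} :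
    G.IsAcyclic ↔ ∀ C : G.ConnectedComponent, C.toSimpleGraph.IsTree := by
  refine ⟨fun h C => h.isTree_connectedComponent C, fun h v w hw => ?_⟩
  have hs : ∀ x ∈ w.support, x ∈ (G.connectedComponentMk v).supp := fun x hx =>
    by
    classical exact ConnectedComponent.sound (w.takeUntil x hx).reachable.symm
  refine (h (G.connectedComponentMk v)).isAcyclic (w.induce _ hs) (Walk.IsCycle.of_map
    (f := (Embedding.induce _).toHom) ?_)
  rwa [Walk.map_induce]

theorem sum_card_neighborSet {U : Type*} [Fintype U] (K : SimpleGraph U) :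
    ∑ v, Nat.card (K.neighborSet v) = 2 * Nat.card K.edgeSet := by
  classical
  rw [Nat.card_eq_fintype_card, ← edgeFinset_card, ← sum_degrees_eq_twice_card_edges]
  exact Finset.sum_congr rfl fun v _ => by
    rw [Nat.card_eq_fintype_card, card_neighborSet_eq_degree]

theorem sum_card_edgeSet_toSimpleGraph {W : Type*} [Finite W] (G : SimpleGraph W)
    [Fintype G.ConnectedComponent] :
    ∑ C : G.ConnectedComponent, Nat.card C.toSimpleGraph.edgeSet = Nat.card G.edgeSet := by
  classical
  have := Fintype.ofFinite W
  have h1 := sum_card_neighborSet G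
  have h2 : ∀ C : G.ConnectedComponent,
      ∑ v : C.supp, Nat.card (G.neighborSet v) = 2 * Nat.card C.toSimpleGraph.edgeSet := by
    intro C
    rw [← sum_card_neighborSet C.toSimpleGraph]
    refine Finset.sum_congr (by ext; simp) fun v _ => (Nat.card_congr ?_).symm
    exact
      { toFun := fun w => ⟨w.1.1, w.2⟩
        invFun := fun w => ⟨⟨w.1, C.mem_supp_of_adj_mem_supp v.2 w.2⟩, w.2⟩
        left_inv := fun _ => rfl
        right_inv := fun _ => rfl }
  have h3 : ∑ C : G.ConnectedComponent, ∑ v : C.supp, Nat.card (G.neighborSet v) =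
      ∑ v, Nat.card (G.neighborSet v) := by
    rw [← Fintype.sum_sigma' fun (C : G.ConnectedComponent) (v : C.supp) =>
      Nat.card (G.neighborSet v)]
    let e : (Σ C : G.ConnectedComponent, C.supp) ≃ W :=
      Equiv.sigmaFiberEquiv G.connectedComponentMk
    exact Fintype.sum_equiv e _ (fun v => Nat.card (G.neighborSet v)) fun _ => rfl
  rw [Finset.sum_congr rfl fun C _ => h2 C, ← Finset.mul_sum, h1] at h3
  exact Nat.eq_of_mul_eq_mul_left two_pos h3

theorem card_le_card_edgeSet_add_card_connectedComponent {W : Type*} [Finite W]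
    (G : SimpleGraph W) :
    Nat.card W ≤ Nat.card G.edgeSet + Nat.card G.ConnectedComponent ∧
      (Nat.card W = Nat.card G.edgeSet + Nat.card G.ConnectedComponent ↔ G.IsAcyclic) := by
  classical
  have := Fintype.ofFinite W
  have := Fintype.ofFinite G.ConnectedComponent
  have hW : Nat.card W = ∑ C : G.ConnectedComponent, Nat.card C.supp := by
    rw [← Nat.card_sigma]
    exact (Nat.card_congr (Equiv.sigmaFiberEquiv G.connectedComponentMk)).symm
  have hr : Nat.card G.edgeSet + Nat.card G.ConnectedComponent =
      ∑ C : G.ConnectedComponent, (Nat.card C.toSimpleGraph.edgeSet + 1) := by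
    rw [Finset.sum_add_distrib, sum_card_edgeSet_toSimpleGraph]
    simp
  have hle : ∀ C ∈ (Finset.univ : Finset G.ConnectedComponent),
      Nat.card C.supp ≤ Nat.card C.toSimpleGraph.edgeSet + 1 := fun C _ =>
    C.connected_toSimpleGraph.card_vert_le_card_edgeSet_add_one
  rw [hW, hr]
  refine ⟨Finset.sum_le_sum hle, ?_⟩
  rw [Finset.sum_eq_sum_iff_of_le hle, isAcyclic_iff_forall_isTree_toSimpleGraph]
  refine forall_congr' fun C => ?_
  rw [isTree_iff_connected_and_card]
  simp only [Finset.mem_univ, true_imp_iff, C.connected_toSimpleGraph, true_and]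
  exact eq_comm

end SimpleGraph

/-! ### The rank deficit as a cyclomatic number -/

namespace FinHypergraph

variable {V E : Type*} (H : FinHypergraph V E)

theorem bip_adj_inr_inl {v : V} {e : E} : H.bip.Adj (.inr e) (.inl v) ↔ v ∈ H.verts e := Iff.rfl

theorem degree_inr (e : E) [Fintype (H.bip.neighborSet (.inr e))] :
    H.bip.degree (.inr e) = (H.verts e).card := by
  rw [← SimpleGraph.card_neighborSet_eq_degree, ← Nat.card_eq_fintype_card, Nat.card_coe_set_eq]
  have : H.bip.neighborSet (.inr e) = Sum.inl '' (H.verts e : Set V) := by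
    ext (v | e')
    · simp [bip_adj_inr_inl]
    · simp only [SimpleGraph.mem_neighborSet, Set.mem_image, reduceCtorEq, and_false, exists_false,
        iff_false]
      exact id
  rw [this, Set.ncard_image_of_injective _ Sum.inl_injective, Set.ncard_coe_finset]

/-- The vertices of the restriction of the bipartite graph to `F`. -/
abbrev restrictVerts (F : Finset E) : Set (V ⊕ E) :=
  Sum.inl '' H.unionVerts F ∪ Sum.inr '' (F : Set E)

theorem inl_mem_restrictVerts {F : Finset E} {v : V} :
    Sum.inl v ∈ H.restrictVerts F ↔ v ∈ H.unionVerts F := by simp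

theorem inr_mem_restrictVerts {F : Finset E} {e : E} :
    Sum.inr e ∈ H.restrictVerts F ↔ e ∈ F := by simp

theorem card_restrictVerts [Finite V] (F : Finset E) :
    Nat.card (H.restrictVerts F) = (H.unionVerts F).ncard + F.card := by
  rw [Nat.card_coe_set_eq, Set.ncard_union_eq ?_ (Set.toFinite _) (Set.toFinite _),
    Set.ncard_image_of_injective _ Sum.inl_injective,
    Set.ncard_image_of_injective _ Sum.inr_injective, Set.ncard_coe_finset]
  rw [Set.disjoint_left]
  rintro _ ⟨v, -, rfl⟩ ⟨e, -, h⟩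
  exact Sum.inr_ne_inl h

theorem card_edgeSet_bipRestrict (F : Finset E) :
    Nat.card (H.bipRestrict F).edgeSet = ∑ e ∈ F, (H.verts e).card := by
  have h : ∑ e ∈ F, (H.verts e).card = Nat.card (Σ e : F, H.verts e) := by
    rw [Nat.card_sigma, ← Finset.sum_coe_sort]
    simp
  rw [h]
  symm
  refine Nat.card_eq_of_bijective (fun x : Σ e : F, H.verts e =>
    (⟨s(⟨Sum.inl x.2.1, H.inl_mem_restrictVerts.2 ⟨x.1.1, x.1.2, x.2.2⟩⟩,
      ⟨Sum.inr x.1.1, H.inr_mem_restrictVerts.2 x.1.2⟩), x.2.2⟩ : (H.bipRestrict F).edgeSet))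
    ⟨?_, ?_⟩
  · rintro ⟨⟨e, he⟩, ⟨v, hv⟩⟩ ⟨⟨e', he'⟩, ⟨v', hv'⟩⟩ h
    have h' : v = v' ∧ e = e' := by
      simpa using Sym2.eq_iff.1 (Subtype.ext_iff.1 h)
    obtain ⟨rfl, rfl⟩ := h'
    rfl
  · rintro ⟨x, hx⟩
    induction x using Sym2.ind with
    | _ x y =>
      rcases x with ⟨v | e, hx'⟩ <;> rcases y with ⟨w | e', hy'⟩
      · exact hx.elim
      · exact ⟨⟨⟨e', H.inr_mem_restrictVerts.1 hy'⟩, ⟨v, hx⟩⟩, rfl⟩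
      · exact ⟨⟨⟨e, H.inr_mem_restrictVerts.1 hx'⟩, ⟨w, hx⟩⟩, Subtype.ext Sym2.eq_swap⟩
      · exact hx.elim

theorem rank_eq (F : Finset E) :
    H.rank F = ((H.unionVerts F).ncard : ℤ) - (H.numComponents F : ℤ) := by
  rw [rank]
  split_ifs with h
  · subst h
    have h1 : H.unionVerts (∅ : Finset E) = ∅ := by simp [unionVerts]
    have : IsEmpty (H.restrictVerts (∅ : Finset E)) := by
      simp [restrictVerts, h1]
    have : IsEmpty (H.bipRestrict (∅ : Finset E)).ConnectedComponent :=
      ⟨fun C => C.ind fun v => this.false v⟩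
    simp only [numComponents, Nat.card_of_isEmpty, h1]
    simp
  · rfl

/-- The nullity of the restriction of the bipartite graph to `F`. -/
theorem rank_le_and_eq_iff_isAcyclic [Finite V] (F : Finset E) :
    H.rank F ≤ ∑ e ∈ F, (((H.verts e).card : ℤ) - 1) ∧
      (∑ e ∈ F, (((H.verts e).card : ℤ) - 1) = H.rank F ↔ (H.bipRestrict F).IsAcyclic) := by
  have : Finite (H.restrictVerts F) := by
    rw [restrictVerts, Set.finite_coe_iff]
    exact Set.toFinite _
  obtain ⟨h1, h2⟩ := (H.bipRestrict F).card_le_card_edgeSet_add_card_connectedComponent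
  rw [← h2]
  rw [card_edgeSet_bipRestrict, card_restrictVerts, ← numComponents] at *
  rw [rank_eq, Finset.sum_sub_distrib]
  simp only [Finset.sum_const, nsmul_eq_mul, mul_one]
  zify at *
  omega

end FinHypergraph

/-! ### Monotonicity and submodularity of the rank through linear algebra -/

namespace FinHypergraph

variable {V E : Type*} (H : FinHypergraph V E)

/-- The functions on the vertices which are constant on every hyperedge in `F`. -/
def constOn (F : Finset E) : Submodule ℚ (V → ℚ) where
  carrier := {φ | ∀ e ∈ F, ∀ v ∈ H.verts e, ∀ w ∈ H.verts e, φ v = φ w}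
  add_mem' := fun {φ ψ} hφ hψ e he v hv w hw => by
    rw [Pi.add_apply, Pi.add_apply, hφ e he v hv w hw, hψ e he v hv w hw]
  zero_mem' := fun _ _ _ _ _ _ => rfl
  smul_mem' := fun c φ hφ e he v hv w hw => by
    rw [Pi.smul_apply, Pi.smul_apply, hφ e he v hv w hw]

/-- The component of a vertex covered by `F`. -/
def componentOf (F : Finset E) (v : H.unionVerts F) : (H.bipRestrict F).ConnectedComponent :=
  (H.bipRestrict F).connectedComponentMk ⟨.inl v, H.inl_mem_restrictVerts.2 v.2⟩

theorem componentOf_eq {F : Finset E} {e : E} (he : e ∈ F) {v : V} (hv : v ∈ H.verts e) :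
    H.componentOf F ⟨v, e, he, hv⟩ =
      (H.bipRestrict F).connectedComponentMk ⟨.inr e, H.inr_mem_restrictVerts.2 he⟩ :=
  SimpleGraph.ConnectedComponent.sound
    (SimpleGraph.Adj.reachable (show H.bip.Adj (.inl v) (.inr e) from hv))

theorem componentOf_surjective (F : Finset E) : Function.Surjective (H.componentOf F) := by
  intro C
  induction C using SimpleGraph.ConnectedComponent.ind with
  | _ x =>
    obtain ⟨v | e, hx⟩ := x
    · exact ⟨⟨v, H.inl_mem_restrictVerts.1 hx⟩, rfl⟩
    · obtain ⟨v, hv⟩ := H.verts_nonempty e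
      exact ⟨_, H.componentOf_eq (H.inr_mem_restrictVerts.1 hx) hv⟩

variable {H} in
/-- Extension of a function constant on the hyperedges in `F` to the bipartite graph. -/
theorem exists_extension {F : Finset E} {φ : V → ℚ} (hφ : φ ∈ H.constOn F) :
    ∃ g : V ⊕ E → ℚ, (∀ v, g (.inl v) = φ v) ∧
      ∀ x ∈ H.restrictVerts F, ∀ y ∈ H.restrictVerts F, H.bip.Adj x y → g x = g y := by
  let g : V ⊕ E → ℚ := Sum.elim φ fun e => φ (H.verts_nonempty e).choose
  have hg : ∀ e ∈ F, ∀ v ∈ H.verts e, g (.inl v) = g (.inr e) := fun e he v hv =>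
    hφ e he v hv _ (H.verts_nonempty e).choose_spec
  refine ⟨g, fun _ => rfl, ?_⟩
  rintro (v | e) hx (w | e') hy hxy
  · exact hxy.elim
  · exact hg e' (H.inr_mem_restrictVerts.1 hy) v hxy
  · exact (hg e (H.inr_mem_restrictVerts.1 hx) w hxy).symm
  · exact hxy.elim

variable {H} in
theorem exists_component_extension {F : Finset E} {φ : V → ℚ} (hφ : φ ∈ H.constOn F) :
    ∃ β : (H.bipRestrict F).ConnectedComponent → ℚ, ∀ v, β (H.componentOf F v) = φ v := by
  obtain ⟨g, hgφ, hg⟩ := exists_extension hφ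
  refine ⟨SimpleGraph.ConnectedComponent.lift (G := H.bipRestrict F) (fun x => g x)
    fun x y p _ => ?_, fun v => hgφ v⟩
  clear *- p hg
  induction p with
  | nil => rfl
  | @cons x y _ h _ ih => exact (hg x x.2 y y.2 h).trans ih

open Classical in
/-- The parametrization of `constOn` by values on components and on uncovered vertices. -/
def constOnParam (F : Finset E) :
    (((H.unionVerts F)ᶜ : Set V) → ℚ) × ((H.bipRestrict F).ConnectedComponent → ℚ) →ₗ[ℚ]
      (V → ℚ) where
  toFun p v := if h : v ∈ H.unionVerts F then p.2 (H.componentOf F ⟨v, h⟩) else p.1 ⟨v, h⟩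
  map_add' p q := by
    ext v
    by_cases h : v ∈ H.unionVerts F <;> simp [h]
  map_smul' c p := by
    ext v
    by_cases h : v ∈ H.unionVerts F <;> simp [h]

theorem constOnParam_apply_of_mem {F : Finset E} {p} {v : V} (h : v ∈ H.unionVerts F) :
    H.constOnParam F p v = p.2 (H.componentOf F ⟨v, h⟩) := dif_pos h

theorem constOnParam_apply_of_notMem {F : Finset E} {p} {v : V} (h : v ∉ H.unionVerts F) :
    H.constOnParam F p v = p.1 ⟨v, h⟩ := dif_neg h

theorem constOnParam_injective (F : Finset E) : Function.Injective (H.constOnParam F) := by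
  intro p q hpq
  refine Prod.ext (funext fun v => ?_) (funext fun C => ?_)
  · rw [← H.constOnParam_apply_of_notMem v.2, hpq, H.constOnParam_apply_of_notMem v.2]
  · obtain ⟨v, rfl⟩ := H.componentOf_surjective F C
    rw [← H.constOnParam_apply_of_mem v.2, hpq, H.constOnParam_apply_of_mem v.2]

theorem range_constOnParam (F : Finset E) :
    LinearMap.range (H.constOnParam F) = H.constOn F := by
  ext φ
  constructor
  · rintro ⟨p, rfl⟩ e he v hv w hw
    rw [H.constOnParam_apply_of_mem ⟨e, he, hv⟩, H.constOnParam_apply_of_mem ⟨e, he, hw⟩,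
      H.componentOf_eq he hv, H.componentOf_eq he hw]
  · intro hφ
    obtain ⟨β, hβ⟩ := exists_component_extension hφ
    refine ⟨(fun v => φ v, β), funext fun v => ?_⟩
    by_cases h : v ∈ H.unionVerts F
    · rw [H.constOnParam_apply_of_mem h]
      exact hβ ⟨v, h⟩
    · rw [H.constOnParam_apply_of_notMem h]

/-- A function in `constOn F` is free on each component and each uncovered vertex. The rank thus
becomes a codimension, and its submodularity follows from the dimension formula for `⊔` and `⊓`. -/
theorem rank_eq_sub_finrank [Fintype V] (F : Finset E) :
    H.rank F = (Fintype.card V : ℤ) - Module.finrank ℚ (H.constOn F) := by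
  classical
  have : Finite (H.bipRestrict F).ConnectedComponent :=
    Finite.of_surjective _ (H.componentOf_surjective F)
  have := Fintype.ofFinite (H.bipRestrict F).ConnectedComponent
  have h : Module.finrank ℚ (H.constOn F) = (H.unionVerts F)ᶜ.ncard + H.numComponents F := by
    rw [← range_constOnParam, LinearMap.finrank_range_of_inj (H.constOnParam_injective F),
      Module.finrank_prod, Module.finrank_fintype_fun_eq_card, Module.finrank_fintype_fun_eq_card,
      numComponents, ← Nat.card_eq_fintype_card, ← Nat.card_eq_fintype_card, Nat.card_coe_set_eq]
  have h2 := Set.ncard_add_ncard_compl (H.unionVerts F)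
  rw [Nat.card_eq_fintype_card] at h2
  rw [rank_eq, h]
  omega

theorem constOn_anti : Antitone H.constOn :=
  fun _ _ h _ hφ e he => hφ e (h he)

theorem rank_mono [Fintype V] : Monotone H.rank := by
  intro F G h
  rw [rank_eq_sub_finrank, rank_eq_sub_finrank]
  have := Submodule.finrank_mono (H.constOn_anti h)
  omega

theorem rank_union_add_rank_inter_le [Fintype V] [DecidableEq E] (F G : Finset E) :
    H.rank (F ∪ G) + H.rank (F ∩ G) ≤ H.rank F + H.rank G := by
  simp only [rank_eq_sub_finrank]
  have h1 : H.constOn F ⊓ H.constOn G ≤ H.constOn (F ∪ G) := by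
    rintro φ ⟨hF, hG⟩ e he
    rcases Finset.mem_union.1 he with h | h
    exacts [hF e h, hG e h]
  have h2 : H.constOn F ⊔ H.constOn G ≤ H.constOn (F ∩ G) :=
    sup_le (H.constOn_anti Finset.inter_subset_left) (H.constOn_anti Finset.inter_subset_right)
  have h3 := Submodule.finrank_sup_add_finrank_inf_eq (H.constOn F) (H.constOn G)
  have h4 := Submodule.finrank_mono h1
  have h5 := Submodule.finrank_mono h2
  omega

theorem isSupermodular_sum_sub_rank [Fintype V] [DecidableEq E] :
    Polymatroid.IsSupermodular
      fun F => ∑ e ∈ F, (((H.verts e).card : ℤ) - 1) - H.rank F where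
  empty := by simp [rank]
  nonneg F := sub_nonneg.2 (H.rank_le_and_eq_iff_isAcyclic F).1
  add_le F G := by
    have h1 := H.rank_union_add_rank_inter_le F G
    have h2 := Finset.sum_union_inter (s₁ := F) (s₂ := G) (f := fun e => ((H.verts e).card : ℤ) - 1)
    linarith

theorem rank_univ [Fintype V] [Fintype E] (hH : H.Connected) :
    H.rank Finset.univ = (Fintype.card V : ℤ) - 1 := by
  have hconst : ∀ φ ∈ H.constOn (Finset.univ : Finset E), ∀ v w, φ v = φ w := by
    intro φ hφ v w
    obtain ⟨g, hgφ, hg⟩ := exists_extension hφ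
    have hmem : ∀ x y, H.bip.Adj x y → x ∈ H.restrictVerts (Finset.univ : Finset E) := by
      rintro (v | e) (w | e') h
      · exact h.elim
      · exact H.inl_mem_restrictVerts.2 ⟨e', Finset.mem_univ _, h⟩
      · exact H.inr_mem_restrictVerts.2 (Finset.mem_univ _)
      · exact h.elim
    have hwalk : ∀ x y, H.bip.Walk x y → g x = g y := by
      intro x y p
      induction p with
      | nil => rfl
      | cons h _ ih => exact (hg _ (hmem _ _ h) _ (hmem _ _ h.symm) h).trans ih
    obtain ⟨p⟩ := hH.preconnected (.inl v) (.inl w)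
    rw [← hgφ, ← hgφ, hwalk _ _ p]
  obtain ⟨v₀⟩ : Nonempty V := by
    obtain ⟨v | e⟩ := hH.nonempty
    exacts [⟨v⟩, ⟨(H.verts_nonempty e).choose⟩]
  have h1 : Module.finrank ℚ (H.constOn (Finset.univ : Finset E)) = 1 := by
    refine finrank_eq_one ⟨fun _ => 1, fun _ _ _ _ _ _ => rfl⟩ (fun h => ?_) fun φ => ⟨φ.1 v₀, ?_⟩
    · exact one_ne_zero (congrFun (Subtype.ext_iff.1 h) v₀)
    · refine Subtype.ext (funext fun v => ?_)
      simpa using hconst φ.1 φ.2 v₀ v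
  rw [rank_eq_sub_finrank, h1, Nat.cast_one]

/-! ### Cycles and girth of the bipartite graph -/

/-- The length of a walk in the bipartite graph counts the visits to hyperedges twice, up to
boundary terms. -/
theorem length_walk {x y : V ⊕ E} (w : H.bip.Walk x y) :
    w.length + (if y.isRight then 1 else 0) =
      2 * w.support.tail.countP Sum.isRight + (if x.isRight then 1 else 0) := by
  induction w with
  | nil => simp
  | @cons x z y h p ih =>
    rw [SimpleGraph.Walk.length_cons, SimpleGraph.Walk.support_cons, List.tail_cons,
      ← SimpleGraph.Walk.cons_tail_support, List.countP_cons]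
    rcases x with v | e <;> rcases z with v' | e'
    · exact h.elim
    · simp at ih ⊢
      omega
    · simp at ih ⊢
      omega
    · exact h.elim

open Classical in
theorem length_eq_of_isCycle [Fintype E] {x : V ⊕ E}
    {w : H.bip.Walk x x} (hw : w.IsCycle) :
    w.length = 2 * (Finset.univ.filter fun e : E => Sum.inr e ∈ w.support).card := by
  have h1 : w.length = 2 * w.support.tail.countP Sum.isRight := by
    have := H.length_walk w
    omega
  rw [h1, List.countP_eq_length_filter, ← List.toFinset_card_of_nodup (hw.support_nodup.filter _),
    ← Finset.card_image_of_injective (Finset.univ.filter fun e : E => Sum.inr e ∈ w.support)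
      (Sum.inr_injective (α := V))]
  refine congrArg (2 * Finset.card ·) ?_
  have hx : ∀ y, y ∈ w.support ↔ y ∈ w.support.tail := fun y => by
    rw [← SimpleGraph.Walk.cons_tail_support, List.mem_cons, List.tail_cons, or_iff_right_of_imp]
    rintro rfl
    exact w.end_mem_tail_support hw.not_nil
  ext (v | e)
  · simp
  · simp [hx]

theorem le_egirth_bip_iff [Fintype E] (k : ℕ) :
    ((2 * k + 2 : ℕ) : ℕ∞) ≤ H.bip.egirth ↔
      ∀ F : Finset E, F.card ≤ k → (H.bipRestrict F).IsAcyclic := by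
  classical
  rw [SimpleGraph.le_egirth]
  simp only [Nat.cast_le]
  constructor
  · intro h F hF
    change (H.bip.induce (H.restrictVerts F)).IsAcyclic
    intro x w hw
    set w' := w.map (SimpleGraph.Embedding.induce (G := H.bip) _).toHom with hw'
    have hc : w'.IsCycle := hw.map (SimpleGraph.Embedding.induce (G := H.bip) _).injective
    have h1 := h _ w' hc
    rw [H.length_eq_of_isCycle hc] at h1
    have h2 : (Finset.univ.filter fun e : E => Sum.inr e ∈ w'.support) ⊆ F := by
      intro e he
      simp only [Finset.mem_filter, Finset.mem_univ, true_and, hw',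
        SimpleGraph.Walk.support_map, List.mem_map] at he
      obtain ⟨⟨y, hy⟩, -, rfl⟩ := he
      exact H.inr_mem_restrictVerts.1 hy
    have := Finset.card_le_card h2
    omega
  · intro h x w hw
    by_contra! hlt
    have hlen := H.length_eq_of_isCycle hw
    set F := Finset.univ.filter fun e : E => Sum.inr e ∈ w.support with hF
    have hs : ∀ y ∈ w.support, y ∈ H.restrictVerts F := by
      rintro (v | e) hy
      · rw [inl_mem_restrictVerts]
        -- A vertex on the cycle has a neighbour on the cycle, which is a hyperedge of `F` covering
        -- it.
        have h2 := hw.ncard_neighborSet_toSubgraph_eq_two hy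
        obtain ⟨z, hz⟩ := Set.nonempty_of_ncard_ne_zero (h2.trans_ne two_ne_zero)
        have hz' : z ∈ w.support := w.mem_verts_toSubgraph.1 (w.toSubgraph.edge_vert hz.symm)
        have hadj := hz.adj_sub
        rcases z with v' | e
        · exact hadj.elim
        · exact ⟨e, by simpa [hF] using hz', hadj⟩
      · rw [inr_mem_restrictVerts]
        simpa [hF] using hy
    refine h F (by omega) (w.induce _ hs) (SimpleGraph.Walk.IsCycle.of_map
      (f := (SimpleGraph.Embedding.induce _).toHom) ?_)
    rwa [SimpleGraph.Walk.map_induce]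

end FinHypergraph

end

theorem mainTheorem5 {V E : Type*} [Fintype V] [Fintype E] [LinearOrder E]
    (H : FinHypergraph V E) (hH : H.Connected) (k : ℕ) (hk : k ≤ Fintype.card E) :
    (∀ i : ℕ, i ≤ k →
        H.interiorPolynomial.coeff i =
          Ring.choose
            ((∑ e : E, (H.bip.degree (Sum.inr e) : ℤ)) - (Fintype.card E : ℤ)
              - (Fintype.card V : ℤ) + (i : ℤ)) i) ↔
      ((2 * k + 2 : ℕ) : ℕ∞) ≤ H.bip.egirth := by
  rw [H.le_egirth_bip_iff]
  have key := Polymatroid.forall_coeff_interiorPolynomial_iff H.rank_mono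
    H.isSupermodular_sum_sub_rank k
  simp only [fun F : Finset E => (H.rank_le_and_eq_iff_isAcyclic F).2] at key
  rw [← key]
  -- By connectedness `μ E = |V| - 1`, whose `1` cancels the `-1` in the binomial's `N - 1 + i`.
  have hN : ∑ e : E, (((H.verts e).card : ℤ) - 1) - H.rank Finset.univ - 1 =
      (∑ e : E, (H.bip.degree (Sum.inr e) : ℤ)) - (Fintype.card E : ℤ) - (Fintype.card V : ℤ) := by
    simp only [H.rank_univ hH, Finset.sum_sub_distrib, H.degree_inr, Finset.sum_const,
      Finset.card_univ, nsmul_eq_mul, mul_one]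
    ring
  rw [hN]
  rfl
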